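/- Let $(\Omega_0,\Sigma_0)$ be a standard Borel space and let $\xi=(\xi_n)_{n\ge 0}$ be a sequence of $(\Omega_0,\Sigma_0)$-valued random variables on a standard probability space $(\Omega,\Sigma,\mu)$. Then the following are equivalent: (a) $\xi$ is maximal partially spreadable; (b) $\xi$ is a stationary Markov sequence. Here the notions are as follows. Let $F^+=\langle g_0,g_1,g_2,\ldots\mid g_kg_\ell=g_{\ell+1}g_k \text{ for } 0\le k<\ell<\infty\rangle^+$ be the Thompson monoid. A sequence $\xi'=(\xi'_n)_{n\ge0}$ of $(\Omega_0,\Sigma_0)$-valued random variables on a standard probability space $(\Omega',\Sigma',\mu')$ is *implemented* by measurable $\mu'$-preserving maps $\eta_n\colon\Omega'\to\Omega'$ $(n\ge 0)$ if the following hold. - The assignment $g_n\mapsto(f\mapsto f\circ\eta_n)$ is a representation of $F^+$ on functions on $\Omega'$, that is, $f\circ\eta_\ell\circ\eta_k=f\circ\eta_k\circ\eta_{\ell+1}$ for all $f$; equivalently, $\eta_\ell\circ\eta_k=\eta_k\circ\eta_{\ell+1}$ for all $0\le k<\ell$. - (Localization) $\xi'_0=\xi'_0\circ\eta_k$ for all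 $k\ge1$. - (Stationarity) $\xi'_n=\xi'_0\circ\eta_0^n$ for all $n\ge0$. The implementation is *maximal* if $\sigma\{\xi'_0\}=\bigcap_{k\ge1}\mathcal I_{\eta_k}$. Here $\mathcal I_{\eta_k}=\{A\in\Sigma' : \mu'(\eta_k^{-1}(A)\,\triangle\, A)=0\}$ is the $\sigma$-algebra of almost $\eta_k$-invariant sets, and $\sigma\{\xi'_0\}$ is completed in $\Sigma'$ by the $\mu'$-null sets. The sequence $\xi$ is *maximal partially spreadable* if it has the same distribution as some sequence $\xi'$ on some standard probability space that is implemented by such maps with a maximal implementation. The sequence $\xi$ is *stationary* if $(\xi_n,\xi_{n+1},\ldots)$ has the same distribution as $(\xi_0,\xi_1,\ldots)$ for every $n\ge 0$. It is *Markov* if $$\mathbb E_{\sigma\{\xi_0,\ldots,\xi_n\}}\mathbb E_{\sigma\{\xi_{n+1}\}}=\mathbb E_{\sigma\{\xi_n\}}\mathbb E_{\sigma\{\xi_{n+1}\}}\quad\text{on } L^\infty(\Omega,\Sigma,\mu)\text{ for all } n\ge0,$$ where $\mathbb E_{\mathcal G}$ is the conditional expectation onto $L^\infty(\Omega,\mathcal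 G,\mu|_{\mathcal G})$. -/

import Mathlib

open MeasureTheory
open scoped ENNReal

namespace PartialSpread

/-- The `σ`-algebra `Σ^ξ_I` generated by the random variables `ξ i` with `i ∈ I`. -/
@[reducible] def generated {Ω S : Type*} [MeasurableSpace S] (ξ : ℕ → Ω → S) (I : Set ℕ) :
    MeasurableSpace Ω :=
  ⨆ i ∈ I, MeasurableSpace.comap (ξ i) inferInstance

/-- The completion inside `Σ` of a `σ`-algebra `m` on `(Ω, Σ, μ)` by the sets of measure zero:
the sets of `Σ` that agree up to a null set with a set of `m`. -/
@[reducible] def completed {Ω : Type*} (m : MeasurableSpace Ω) {mΩ : MeasurableSpace Ω} (μ : Measure Ω) :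
    MeasurableSpace Ω :=
  eventuallyMeasurableSpace m (ae μ) ⊓ mΩ

/-- The `σ`-algebra of `μ`-almost `f`-invariant sets in `Σ`, that is, of the sets `s ∈ Σ`
such that `f ⁻¹' s` and `s` differ by a null set. -/
@[reducible] def almostInvariants {Ω : Type*} [MeasurableSpace Ω] (μ : Measure Ω) (f : Ω → Ω) :
    MeasurableSpace Ω where
  MeasurableSet' s := MeasurableSet s ∧ f ⁻¹' s =ᵐ[μ] s
  measurableSet_empty := ⟨MeasurableSet.empty, by simp⟩
  measurableSet_compl s hs := ⟨hs.1.compl, by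
    rw [Set.preimage_compl]
    exact hs.2.compl⟩
  measurableSet_iUnion s hs := ⟨MeasurableSet.iUnion fun i => (hs i).1, by
    rw [Set.preimage_iUnion]
    exact Filter.EventuallyEq.countable_iUnion fun i => (hs i).2⟩

/-- `ξ` is stationary: all shifted sequences `(ξ n, ξ (n + 1), …)` have the same law as `ξ`
on the sequence space `ℕ → S` with its product `σ`-algebra. -/
def IsStationary {Ω S : Type*} [MeasurableSpace Ω] [MeasurableSpace S] (μ : Measure Ω)
    (ξ : ℕ → Ω → S) : Prop :=
  ∀ n : ℕ, μ.map (fun ω k => ξ (n + k) ω) = μ.map (fun ω k => ξ k ω)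

/-- `ξ` is a Markov sequence: with `E_m` the conditional expectation given `m`,
`E_{σ(ξ_0, …, ξ_n)} E_{σ(ξ_{n+1})} = E_{σ(ξ_n)} E_{σ(ξ_{n+1})}` on `L^∞(Ω, Σ, μ)` for all `n`.
(Completing the `σ`-algebras by null sets does not change conditional expectations.) -/
def IsMarkov {Ω S : Type*} [MeasurableSpace Ω] [MeasurableSpace S] (μ : Measure Ω)
    (ξ : ℕ → Ω → S) : Prop :=
  ∀ (n : ℕ) (f : Ω → ℂ), MemLp f ∞ μ →
    μ[μ[f | generated ξ {n + 1}] | generated ξ (Set.Iic n)] =ᵐ[μ]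
      μ[μ[f | generated ξ {n + 1}] | generated ξ {n}]

/-- The maps `η n` are a representation of the Thompson monoid
`F⁺ = ⟨g_0, g_1, … | g_k g_l = g_{l+1} g_k for k < l⟩⁺` by measure-preserving measurable maps of
`(Ω, Σ, μ)` that implements the sequence `ξ`. A generator `g_n` acts on functions by
`f ↦ f ∘ η n`. As composition on the right reverses the order of factors, the relation
`g_k g_l = g_{l+1} g_k` reads `f ∘ η l ∘ η k = f ∘ η k ∘ η (l + 1)`. -/
structure IsImplementedBy {Ω S : Type*} [MeasurableSpace Ω] (μ : Measure Ω) (ξ : ℕ → Ω → S)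
    (η : ℕ → Ω → Ω) : Prop where
  measurePreserving : ∀ n, MeasurePreserving (η n) μ μ
  relations : ∀ k l, k < l → η l ∘ η k = η k ∘ η (l + 1)
  localization : ∀ k, 0 < k → ξ 0 = ξ 0 ∘ η k
  stationarity : ∀ n, ξ n = ξ 0 ∘ (η 0)^[n]

/-- Maximality of an implementation: `σ{ξ_0}`, completed by null sets, is the intersection of
the `σ`-algebras of `μ`-almost `η_k`-invariant sets with `k ≥ 1`. -/
def IsMaximalFor {Ω S : Type*} [MeasurableSpace Ω] [MeasurableSpace S] (μ : Measure Ω)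
    (ξ : ℕ → Ω → S) (η : ℕ → Ω → Ω) : Prop :=
  completed (generated ξ {0}) μ = ⨅ k ∈ Set.Ici 1, almostInvariants μ (η k)

universe u v

/-- `ξ` is maximal partially spreadable: it has the same law as a sequence `ξ'` of random
variables on a standard probability space on which the Thompson monoid is represented so that
`ξ'` is implemented by this representation and maximal for it. -/
def IsMaximalPartiallySpreadable {Ω : Type u} {S : Type v} [MeasurableSpace Ω]
    [MeasurableSpace S] (μ : Measure Ω) (ξ : ℕ → Ω → S) : Prop :=
  ∃ (Ω' : Type u) (_ : MeasurableSpace Ω') (_ : StandardBorelSpace Ω') (μ' : Measure Ω')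
    (ξ' : ℕ → Ω' → S) (η : ℕ → Ω' → Ω'),
    IsProbabilityMeasure μ' ∧ (∀ n, Measurable (ξ' n)) ∧
    IsImplementedBy μ' ξ' η ∧ IsMaximalFor μ' ξ' η ∧
    μ.map (fun ω n => ξ n ω) = μ'.map (fun ω n => ξ' n ω)

end PartialSpread

/-! Spreadable to Markov. Stationarity holds because `η 0` preserves the measure. Let `U k` be the
isometry `f ↦ f ∘ η k` of `L²`. By maximality, vectors fixed by all `U k` with `k ≥ 1` are `σ(ξ
0)`-measurable, so `w = h(ξ 1) - E[h(ξ 1) | ξ 0]` is orthogonal to them. A contraction and its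
adjoint fix the same vectors; hence the relations `U 0 * U l = U (l + 1) * U 0` make the adjoint of
`U 0` lower the threshold of fixedness by one, and `U 0 ^ n w` is orthogonal to everything fixed by
all `U k` with `k > n` (`inner_iterate_eq_zero`). Indicators of events of the past up to `n` are
fixed in this way, and this orthogonality is the Markov property.

Markov to spreadable. Write the transition kernel as a random map `φ(x, u)` with `u` uniform, and
attach to the state an i.i.d. sequence of such `u`. Let `η 0` apply `φ` with the first entry and
discard that entry; let `η (k + 1)` only delete entry `k`. Sets almost invariant under `η 1` have
sections of measure 0 or 1 by ergodicity of the Bernoulli shift, so they depend on the state alone,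
which gives maximality. By the first implication the new sequence is stationary and Markov; it has
the same pair laws as `ξ`, hence the same law (`IsMarkov.map_eq`). -/

namespace PartialSpread

open ProbabilityTheory Filter

/-! ### Markov property and stationarity as properties of the law -/

section General

variable {Ω Ω' S : Type*} [MeasurableSpace S]

lemma generated_singleton (ξ : ℕ → Ω → S) (n : ℕ) :
    generated ξ {n} = MeasurableSpace.comap (ξ n) inferInstance := by
  simp [generated]

lemma generated_mono (ξ : ℕ → Ω → S) {I J : Set ℕ} (h : I ⊆ J) :
    generated ξ I ≤ generated ξ J :=
  biSup_mono h

lemma generated_le [MeasurableSpace Ω] {ξ : ℕ → Ω → S} (hξ : ∀ n, Measurable (ξ n)) (I : Set ℕ) :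
    generated ξ I ≤ ‹MeasurableSpace Ω› :=
  iSup₂_le fun i _ => (hξ i).comap_le

lemma generated_eq_comap (ξ : ℕ → Ω → S) (I : Set ℕ) :
    generated ξ I = MeasurableSpace.comap (fun ω n => ξ n ω)
      (generated (fun n (x : ℕ → S) => x n) I) := by
  simp only [generated, MeasurableSpace.comap_iSup, MeasurableSpace.comap_comp]
  rfl

/-- Conditional expectations of a composition, given a pulled back `σ`-algebra. -/
lemma condExp_comp_comap {m mΩ' : MeasurableSpace Ω'} {mΩ : MeasurableSpace Ω} {μ : Measure Ω}
    [IsFiniteMeasure μ] {X : Ω → Ω'} (hX : Measurable X) (hm : m ≤ mΩ') {F : Ω' → ℂ}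
    (hF : Integrable F (μ.map X)) :
    μ[F ∘ X | m.comap X] =ᵐ[μ] (μ.map X)[F | m] ∘ X := by
  have hc : m.comap X ≤ mΩ :=
    (MeasurableSpace.comap_mono hm).trans hX.comap_le
  have hi : Integrable ((μ.map X)[F | m]) (μ.map X) := integrable_condExp
  symm
  apply ae_eq_condExp_of_forall_setIntegral_eq hc (hF.comp_measurable hX)
  · intro s _ _
    exact (hi.comp_measurable hX).integrableOn
  · rintro _ ⟨t, ht, rfl⟩ -
    have key : ∀ G : Ω' → ℂ, Integrable G (μ.map X) →
        ∫ ω in X ⁻¹' t, (G ∘ X) ω ∂μ = ∫ y in t, G y ∂(μ.map X) := by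
      intro G hG
      exact (setIntegral_map (hm _ ht) hG.aestronglyMeasurable hX.aemeasurable).symm
    rw [key _ hi, key _ hF, setIntegral_condExp hm hF ht]
  · exact (stronglyMeasurable_condExp.comp_measurable
      (comap_measurable X)).aestronglyMeasurable

variable [MeasurableSpace Ω] [MeasurableSpace Ω']

/-- By Doob–Dynkin, the inner conditional expectation is a measurable function of `ξ (n + 1)`, so it
suffices to test such functions. -/
lemma isMarkov_iff {μ : Measure Ω} [IsProbabilityMeasure μ] {ξ : ℕ → Ω → S}
    (hξ : ∀ n, Measurable (ξ n)) :
    IsMarkov μ ξ ↔ ∀ (n : ℕ) (h : S → ℂ), Measurable h → MemLp (h ∘ ξ (n + 1)) ∞ μ →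
      μ[h ∘ ξ (n + 1) | generated ξ (Set.Iic n)] =ᵐ[μ] μ[h ∘ ξ (n + 1) | generated ξ {n}] := by
  constructor
  · intro H n h hh hL
    have h1 : μ[h ∘ ξ (n + 1) | generated ξ {n + 1}] = h ∘ ξ (n + 1) := by
      apply condExp_of_stronglyMeasurable (generated_le hξ _)
      · rw [generated_singleton]
        exact (hh.comp (comap_measurable _)).stronglyMeasurable
      · exact hL.integrable le_top
    simpa only [h1] using H n _ hL
  · intro H n f hf
    have hm : Measurable[MeasurableSpace.comap (ξ (n + 1)) inferInstance]
        (μ[f | generated ξ {n + 1}]) := by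
      rw [← generated_singleton]
      exact stronglyMeasurable_condExp.measurable
    obtain ⟨h, hh, e⟩ := hm.exists_eq_measurable_comp
    have hL : MemLp (μ[f | generated ξ {n + 1}]) ∞ μ := hf.condExp le_top
    rw [e] at hL ⊢
    exact H n h hh hL

/-- Both conditional expectations are pulled back from the path space, where they depend only on the
common law. -/
lemma isMarkov_of_map_eq {μ : Measure Ω} {μ' : Measure Ω'} [IsProbabilityMeasure μ]
    [IsProbabilityMeasure μ'] {ξ : ℕ → Ω → S} {ξ' : ℕ → Ω' → S} (hξ : ∀ n, Measurable (ξ n))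
    (hξ' : ∀ n, Measurable (ξ' n))
    (hlaw : μ.map (fun ω n => ξ n ω) = μ'.map (fun ω n => ξ' n ω)) (H : IsMarkov μ' ξ') :
    IsMarkov μ ξ := by
  rw [isMarkov_iff hξ'] at H
  rw [isMarkov_iff hξ]
  intro n h hh hL
  set X : Ω → ℕ → S := fun ω n => ξ n ω
  set X' : Ω' → ℕ → S := fun ω n => ξ' n ω
  have hX : Measurable X := measurable_pi_lambda _ hξ
  have hX' : Measurable X' := measurable_pi_lambda _ hξ'
  set F : (ℕ → S) → ℂ := fun x => h (x (n + 1))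
  have hF : Measurable F := hh.comp (measurable_pi_apply _)
  have hLF : MemLp F ∞ (μ.map X) :=
    (memLp_map_measure_iff hF.aestronglyMeasurable hX.aemeasurable).2 hL
  have hLF' : MemLp F ∞ (μ'.map X') := hlaw ▸ hLF
  have hL' : MemLp (h ∘ ξ' (n + 1)) ∞ μ' :=
    (memLp_map_measure_iff hF.aestronglyMeasurable hX'.aemeasurable).1 hLF'
  have : IsProbabilityMeasure (μ.map X) := Measure.isProbabilityMeasure_map hX.aemeasurable
  have hle := generated_le (ξ := fun n (x : ℕ → S) => x n) (fun n => measurable_pi_apply n)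
  have e : ∀ I, μ[h ∘ ξ (n + 1) | generated ξ I] =ᵐ[μ]
      (μ.map X)[F | generated (fun n (x : ℕ → S) => x n) I] ∘ X := by
    intro I
    rw [generated_eq_comap]
    exact condExp_comp_comap hX (hle I) (hLF.integrable le_top)
  have e' : ∀ I, μ'[h ∘ ξ' (n + 1) | generated ξ' I] =ᵐ[μ']
      (μ.map X)[F | generated (fun n (x : ℕ → S) => x n) I] ∘ X' := by
    intro I
    rw [generated_eq_comap, hlaw]
    have : IsProbabilityMeasure (μ'.map X') := Measure.isProbabilityMeasure_map hX'.aemeasurable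
    exact condExp_comp_comap hX' (hle I) (hLF'.integrable le_top)
  have h2 := ((e' _).symm.trans (H n h hh hL')).trans (e' _)
  have h3 : (μ.map X)[F | generated (fun n (x : ℕ → S) => x n) (Set.Iic n)] =ᵐ[μ.map X]
      (μ.map X)[F | generated (fun n (x : ℕ → S) => x n) {n}] := by
    have hmeas : ∀ I, Measurable ((μ.map X)[F | generated (fun n (x : ℕ → S) => x n) I]) :=
      fun I => (stronglyMeasurable_condExp.mono (hle I)).measurable
    have := (ae_map_iff hX'.aemeasurable (measurableSet_eq_fun (hmeas (Set.Iic n)) (hmeas {n}))).2 h2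
    rwa [← hlaw] at this
  exact ((e _).trans (ae_eq_comp hX.aemeasurable h3)).trans (e _).symm

lemma isStationary_of_map_eq {μ : Measure Ω} {μ' : Measure Ω'} {ξ : ℕ → Ω → S} {ξ' : ℕ → Ω' → S}
    (hξ : ∀ n, Measurable (ξ n)) (hξ' : ∀ n, Measurable (ξ' n))
    (hlaw : μ.map (fun ω n => ξ n ω) = μ'.map (fun ω n => ξ' n ω)) (H : IsStationary μ' ξ') :
    IsStationary μ ξ := by
  intro n
  have hs : Measurable (fun (x : ℕ → S) k => x (n + k)) := by fun_prop
  have h1 := congrArg (Measure.map fun (x : ℕ → S) k => x (n + k)) hlaw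
  rw [Measure.map_map hs (measurable_pi_lambda _ hξ),
    Measure.map_map hs (measurable_pi_lambda _ hξ')] at h1
  exact h1.trans ((H n).trans hlaw.symm)

lemma IsImplementedBy.isStationary {μ : Measure Ω} {ξ : ℕ → Ω → S} {η : ℕ → Ω → Ω}
    (H : IsImplementedBy μ ξ η) (hξ : ∀ n, Measurable (ξ n)) : IsStationary μ ξ := by
  intro n
  have hp := (H.measurePreserving 0).iterate n
  conv_rhs => rw [← hp.map_eq]
  rw [Measure.map_map (measurable_pi_lambda _ hξ) hp.measurable]
  congr 1
  ext ω k
  rw [H.stationarity (n + k), add_comm n k, Function.iterate_add]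
  exact (congrFun (H.stationarity k) _).symm

end General

/-! ### Contractions satisfying the Thompson relations -/

section Isometries

variable {E : Type*} [NormedAddCommGroup E] [InnerProductSpace ℂ E] [CompleteSpace E]

open scoped InnerProductSpace

/-- A contraction fixing `v` has an adjoint fixing `v`. -/
lemma adjoint_fixed (A : E →L[ℂ] E) (hA : ‖A‖ ≤ 1) {v : E} (hv : A v = v) :
    A.adjoint v = v := by
  have h1 : ‖A.adjoint v‖ ≤ ‖v‖ := by
    refine (A.adjoint.le_opNorm v).trans ?_
    rw [LinearIsometryEquiv.norm_map]
    exact mul_le_of_le_one_left (norm_nonneg _) hA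
  -- The cross term is `⟪v, A v⟫ = ‖v‖²`, so the square expands to `‖A* v‖² - ‖v‖²`.
  have h2 : ‖A.adjoint v - v‖ ^ 2 ≤ 0 := by
    rw [@norm_sub_sq ℂ, ContinuousLinearMap.adjoint_inner_left, hv, inner_self_eq_norm_sq]
    nlinarith [norm_nonneg (A.adjoint v), norm_nonneg v]
  have h3 : ‖A.adjoint v - v‖ = 0 := by nlinarith [norm_nonneg (A.adjoint v - v)]
  exact sub_eq_zero.1 (norm_eq_zero.1 h3)

/-- If contractions satisfy the relations of the Thompson monoid, then the iterates of `U 0` map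
vectors orthogonal to the common fixed space of the `U k` with `k > 0` to vectors orthogonal to the
common fixed space of the `U k` with `k > n`. -/
lemma inner_iterate_eq_zero (U : ℕ → E →L[ℂ] E) (hU : ∀ k, ‖U k‖ ≤ 1)
    (rel : ∀ l, 0 < l → U 0 * U l = U (l + 1) * U 0) {w : E}
    (hw : ∀ c, (∀ k, 0 < k → U k c = c) → ⟪c, w⟫_ℂ = 0) (n : ℕ) {b : E}
    (hb : ∀ k, n < k → U k b = b) : ⟪b, (U 0 ^ n) w⟫_ℂ = 0 := by
  induction n generalizing b with
  | zero => simpa using hw b hb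
  | succ n ih =>
    -- One factor `U 0` moves to the other side; it remains to see that its adjoint sends `b` to a
    -- vector fixed by all `U k` with `k > n`.
    rw [pow_succ', mul_apply_eq_comp, ← ContinuousLinearMap.adjoint_inner_left]
    refine ih fun k hk => ?_
    have h1 : (U k).adjoint ((U 0).adjoint b) = (U 0).adjoint b := by
      have := congrArg ContinuousLinearMap.adjoint (rel k (by omega))
      simp only [ContinuousLinearMap.mul_def, ContinuousLinearMap.adjoint_comp] at this
      have h2 := DFunLike.congr_fun this b
      simp only [ContinuousLinearMap.comp_apply] at h2
      rw [h2, adjoint_fixed _ (hU _) (hb (k + 1) (by omega))]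
    have h3 := adjoint_fixed (U k).adjoint (by rw [LinearIsometryEquiv.norm_map]; exact hU k) h1
    rwa [ContinuousLinearMap.adjoint_adjoint] at h3

end Isometries

/-! ### Conditional expectation and completion by null sets -/

section Completion

variable {Ω : Type*} {m mΩ : MeasurableSpace Ω} {μ : Measure Ω}

lemma le_completed (hm : m ≤ mΩ) : m ≤ completed m μ :=
  le_inf le_eventuallyMeasurableSpace hm

lemma condExp_completed [IsFiniteMeasure μ] (hm : m ≤ mΩ) {f : Ω → ℂ} (hf : Integrable f μ) :
    μ[f | m] =ᵐ[μ] μ[f | completed m μ] := by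
  apply ae_eq_condExp_of_forall_setIntegral_eq (inf_le_right : completed m μ ≤ mΩ) hf
  · exact fun s _ _ => integrable_condExp.integrableOn
  · rintro s ⟨⟨t, ht, hst⟩, -⟩ -
    rw [setIntegral_congr_set hst, setIntegral_congr_set hst, setIntegral_condExp hm hf ht]
  · exact (stronglyMeasurable_condExp.mono (le_completed hm)).aestronglyMeasurable

lemma aestronglyMeasurable_of_completed [IsFiniteMeasure μ] (hm : m ≤ mΩ) {f : Ω → ℂ}
    (hf : Integrable f μ) (hmeas : Measurable[completed m μ] f) :
    AEStronglyMeasurable[m] f μ := by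
  refine ⟨μ[f | m], stronglyMeasurable_condExp, ?_⟩
  have h := condExp_of_stronglyMeasurable (inf_le_right : completed m μ ≤ mΩ)
    hmeas.stronglyMeasurable hf
  conv_lhs => rw [← h]
  exact (condExp_completed hm hf).symm

end Completion

/-! ### Koopman isometries, and the Markov property from maximality -/

section Implementation

variable {Ω S : Type*} [MeasurableSpace Ω] {μ : Measure Ω}
  {ξ : ℕ → Ω → S} {η : ℕ → Ω → Ω}

/-- The isometry `f ↦ f ∘ η k` of `L²`. -/
noncomputable def IsImplementedBy.koopman (H : IsImplementedBy μ ξ η) (k : ℕ) :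
    Lp ℂ 2 μ →L[ℂ] Lp ℂ 2 μ :=
  (Lp.compMeasurePreservingₗᵢ ℂ (η k) (H.measurePreserving k)).toContinuousLinearMap

lemma IsImplementedBy.coeFn_koopman (H : IsImplementedBy μ ξ η) (k : ℕ) (f : Lp ℂ 2 μ) :
    H.koopman k f =ᵐ[μ] f ∘ η k :=
  Lp.coeFn_compMeasurePreserving f (H.measurePreserving k)

lemma IsImplementedBy.koopman_toLp (H : IsImplementedBy μ ξ η) (k : ℕ) {f : Ω → ℂ}
    (hf : MemLp f 2 μ) :
    H.koopman k hf.toLp = (hf.comp_measurePreserving (H.measurePreserving k)).toLp := by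
  apply Lp.ext
  refine (H.coeFn_koopman k _).trans (EventuallyEq.trans ?_ (MemLp.coeFn_toLp _).symm)
  exact (H.measurePreserving k).quasiMeasurePreserving.ae_eq_comp hf.coeFn_toLp

lemma IsImplementedBy.koopman_pow_toLp (H : IsImplementedBy μ ξ η) (k n : ℕ) {f : Ω → ℂ}
    (hf : MemLp f 2 μ) :
    (H.koopman k ^ n) hf.toLp =
      (hf.comp_measurePreserving ((H.measurePreserving k).iterate n)).toLp := by
  induction n with
  | zero => rfl
  | succ n ih =>
    rw [pow_succ', mul_apply_eq_comp, ih, H.koopman_toLp]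
    rfl

lemma IsImplementedBy.koopman_relation (H : IsImplementedBy μ ξ η) {l : ℕ} (hl : 0 < l) :
    H.koopman 0 * H.koopman l = H.koopman (l + 1) * H.koopman 0 := by
  ext1 f
  have h : MemLp f 2 μ := Lp.memLp f
  rw [← Lp.toLp_coeFn f h, mul_apply_eq_comp, mul_apply_eq_comp]
  simp only [H.koopman_toLp]
  congr 1
  exact congrArg (f ∘ ·) (H.relations 0 l hl)

/-- Moving `η k` leftwards through the `n` factors `η 0` of `ξ n` lowers its index to `k - n > 0`,
where localization absorbs it. -/
lemma IsImplementedBy.comp_of_lt (H : IsImplementedBy μ ξ η) {n k : ℕ} (hk : n < k) :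
    ξ n ∘ η k = ξ n := by
  have h : ∀ n l, 0 < l → (η 0)^[n] ∘ η (l + n) = η l ∘ (η 0)^[n] := by
    intro n l hl
    induction n with
    | zero => rfl
    | succ n ih =>
      rw [Function.iterate_succ, ← Function.comp_assoc, ← ih, Function.comp_assoc,
        Function.comp_assoc, ← add_assoc, H.relations 0 (l + n) (by omega)]
  obtain ⟨l, rfl⟩ := Nat.exists_eq_add_of_lt hk
  rw [H.stationarity n, Function.comp_assoc, show n + l + 1 = l + 1 + n by ring, h n _ (by omega),
    ← Function.comp_assoc, ← H.localization (l + 1) (by omega)]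

variable [MeasurableSpace S]

lemma IsImplementedBy.generated_le_almostInvariants (H : IsImplementedBy μ ξ η)
    (hξ : ∀ n, Measurable (ξ n)) {n k : ℕ} (hk : n < k) :
    generated ξ (Set.Iic n) ≤ almostInvariants μ (η k) := by
  refine iSup₂_le fun i hi => ?_
  rintro _ ⟨t, ht, rfl⟩
  refine ⟨hξ i ht, ?_⟩
  rw [← Set.preimage_comp, H.comp_of_lt (lt_of_le_of_lt hi hk)]
  exact EventuallyEq.rfl

/-- The only use of maximality in this direction: level sets of a fixed vector are almost invariant
under every `η k` with `k ≥ 1`. -/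
lemma IsImplementedBy.aestronglyMeasurable_of_fixed [IsFiniteMeasure μ]
    (H : IsImplementedBy μ ξ η) (hξ : ∀ n, Measurable (ξ n)) (hmax : IsMaximalFor μ ξ η)
    {c : Lp ℂ 2 μ} (hc : ∀ k, 0 < k → H.koopman k c = c) :
    AEStronglyMeasurable[generated ξ {0}] c μ := by
  apply aestronglyMeasurable_of_completed (generated_le hξ _)
    ((Lp.memLp c).integrable one_le_two)
  rw [hmax]
  intro B hB
  simp only [MeasurableSpace.measurableSet_iInf]
  intro k hk
  refine ⟨(Lp.stronglyMeasurable c).measurable hB, ?_⟩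
  have h1 := H.coeFn_koopman k c
  rw [hc k hk] at h1
  exact (h1.preimage B).symm

lemma IsImplementedBy.isMarkov [IsProbabilityMeasure μ]
    (H : IsImplementedBy μ ξ η) (hξ : ∀ n, Measurable (ξ n)) (hmax : IsMaximalFor μ ξ η) :
    IsMarkov μ ξ := by
  rw [isMarkov_iff hξ]
  intro n h hh hL
  have hp := (H.measurePreserving 0).iterate n
  have hξn : ∀ j, ξ (j + n) = ξ j ∘ (η 0)^[n] := fun j => by
    rw [H.stationarity (j + n), H.stationarity j, Function.iterate_add]
    rfl
  have hm0 := generated_le hξ {0}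
  set y : Ω → ℂ := h ∘ ξ 1
  have hyn : h ∘ ξ (n + 1) = y ∘ (η 0)^[n] := by
    rw [add_comm, hξn]; rfl
  have hym : Measurable y := hh.comp (hξ 1)
  -- Boundedness is given for `h ∘ ξ (n + 1)` only; it passes to `y` since `(η 0)^[n]` preserves the
  -- measure.
  have hyL : MemLp y 2 μ := by
    refine MemLp.mono_exponent (q := ∞) ?_ le_top
    rw [hyn, ← memLp_map_measure_iff (hp.map_eq.symm ▸ hym.aestronglyMeasurable) hp.aemeasurable,
      hp.map_eq] at hL
    exact hL
  obtain ⟨k, hk, ek⟩ : ∃ k : S → ℂ, Measurable k ∧ μ[y | generated ξ {0}] = k ∘ ξ 0 := by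
    have hm : Measurable[MeasurableSpace.comap (ξ 0) inferInstance] (μ[y | generated ξ {0}]) := by
      rw [← generated_singleton]
      exact stronglyMeasurable_condExp.measurable
    exact hm.exists_eq_measurable_comp
  have hcL : MemLp (μ[y | generated ξ {0}]) 2 μ := hyL.condExp one_le_two
  -- On `L²` the conditional expectation is the orthogonal projection onto the `σ(ξ 0)`-measurable
  -- vectors, which include `c`.
  have hw : ∀ c, (∀ k, 0 < k → H.koopman k c = c) →
      inner ℂ c (hyL.toLp - hcL.toLp) = 0 := by
    intro c hc
    have e : hcL.toLp = (condExpL2 ℂ ℂ hm0 hyL.toLp : Lp ℂ 2 μ) := by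
      apply Lp.ext
      exact hcL.coeFn_toLp.trans (hyL.condExpL2_ae_eq_condExp hm0 (𝕜 := ℂ)).symm
    have hmem : c ∈ lpMeas ℂ ℂ (generated ξ {0}) 2 μ :=
      mem_lpMeas_iff_aestronglyMeasurable.2 (H.aestronglyMeasurable_of_fixed hξ hmax hc)
    have : Fact (generated ξ {0} ≤ ‹MeasurableSpace Ω›) := ⟨hm0⟩
    rw [e]
    exact Submodule.inner_right_of_mem_orthogonal hmem
      (Submodule.sub_starProjection_mem_orthogonal _)
  have key := fun b hb => inner_iterate_eq_zero H.koopman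
    (fun k => LinearIsometry.norm_toContinuousLinearMap_le _) (fun l hl => H.koopman_relation hl) hw
    n (b := b) hb
  have hmn := generated_le hξ (Set.Iic n)
  have hint : Integrable (h ∘ ξ (n + 1)) μ := hL.integrable le_top
  have hkL : MemLp (k ∘ ξ n) 2 μ := by
    have := hcL.comp_measurePreserving hp
    rwa [ek, Function.comp_assoc, ← hξn, zero_add] at this
  have hkm : StronglyMeasurable[generated ξ {n}] (k ∘ ξ n) := by
    rw [generated_singleton]
    exact (hk.comp (comap_measurable _)).stronglyMeasurable
  have hmono : generated ξ {n} ≤ generated ξ (Set.Iic n) :=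
    generated_mono ξ (by simp)
  have h1 : k ∘ ξ n =ᵐ[μ] μ[h ∘ ξ (n + 1) | generated ξ (Set.Iic n)] := by
    apply ae_eq_condExp_of_forall_setIntegral_eq hmn hint
    · exact fun s _ _ => (hkL.integrable one_le_two).integrableOn
    · intro s hs _
      have hsm := hmn _ hs
      -- Here `U 0 ^ n` turns `y - E[y | ξ 0]` into `h ∘ ξ (n + 1) - k ∘ ξ n`; pairing with the
      -- indicator of a past event `s` gives equal integrals over `s`.
      have hb := key (indicatorConstLp 2 hsm (measure_ne_top μ s) (1 : ℂ)) ?_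
      · rw [map_sub, H.koopman_pow_toLp, H.koopman_pow_toLp, inner_sub_right,
          L2.inner_indicatorConstLp_one, L2.inner_indicatorConstLp_one, sub_eq_zero] at hb
        rw [setIntegral_congr_ae hsm ((MemLp.coeFn_toLp _).mono fun _ h _ => h),
          setIntegral_congr_ae hsm ((MemLp.coeFn_toLp _).mono fun _ h _ => h)] at hb
        rw [hyn, hb, ek, Function.comp_assoc, ← hξn, zero_add]
      · intro j hj
        refine (Lp.indicatorConstLp_compMeasurePreserving hsm (measure_ne_top μ s) 1
          (H.measurePreserving j)).trans ?_
        refine Lp.ext (indicatorConstLp_coeFn.trans (EventuallyEq.trans ?_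
          indicatorConstLp_coeFn.symm))
        exact indicator_ae_eq_of_ae_eq_set (H.generated_le_almostInvariants hξ hj s hs).2
    · exact (hkm.mono hmono).aestronglyMeasurable
  have h2 : k ∘ ξ n =ᵐ[μ] μ[h ∘ ξ (n + 1) | generated ξ {n}] := by
    have h3 := condExp_condExp_of_le (μ := μ) (f := h ∘ ξ (n + 1)) hmono hmn
    have h4 := condExp_congr_ae (m := generated ξ {n}) h1
    rw [condExp_of_stronglyMeasurable (generated_le hξ _) hkm (hkL.integrable one_le_two)] at h4
    exact h4.trans h3
  exact h1.symm.trans h2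

end Implementation

/-! ### The law of a Markov sequence -/

section Law

variable {Ω Ω' S : Type*} [MeasurableSpace S]

/-- Freezing the path at time `n` encodes every past in the same space `ℕ → S`, which permits an
induction on `n` without changing types. -/
lemma generated_Iic_eq_comap (ξ : ℕ → Ω → S) (n : ℕ) :
    generated ξ (Set.Iic n) = MeasurableSpace.comap (fun ω k => ξ (min k n) ω) inferInstance := by
  simp only [MeasurableSpace.pi, MeasurableSpace.comap_iSup, MeasurableSpace.comap_comp]
  apply le_antisymm
  · refine iSup₂_le fun i hi => le_iSup_of_le i ?_
    rw [Set.mem_Iic] at hi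
    simp [Function.comp_def, min_eq_left hi]
  · exact iSup_le fun i => le_iSup₂_of_le (min i n) (Set.mem_Iic.2 (min_le_right i n)) le_rfl

variable [MeasurableSpace Ω] [MeasurableSpace Ω'] [StandardBorelSpace S] [Nonempty S]
  {μ : Measure Ω} {μ' : Measure Ω'}
  [IsProbabilityMeasure μ] [IsProbabilityMeasure μ'] {ξ : ℕ → Ω → S} {ξ' : ℕ → Ω' → S}

/-- The joint law of the past and the next variable of a Markov sequence on rectangles. -/
lemma IsMarkov.integral_past_inter_next (hξ : ∀ n, Measurable (ξ n)) (H : IsMarkov μ ξ) (n : ℕ)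
    {A : Set (ℕ → S)} (hA : MeasurableSet A) {B : Set S} (hB : MeasurableSet B) :
    ∫ _ω in (fun ω k => ξ (min k n) ω) ⁻¹' A ∩ ξ (n + 1) ⁻¹' B, (1 : ℂ) ∂μ =
      ∫ x in A, ∫ y, B.indicator 1 y ∂condDistrib (ξ (n + 1)) (ξ n) μ (x n)
        ∂(μ.map fun ω k => ξ (min k n) ω) := by
  have hX : Measurable (fun ω k => ξ (min k n) ω) := measurable_pi_lambda _ fun k => hξ _
  set h : S → ℂ := B.indicator 1
  have hh : Measurable h := measurable_one.indicator hB
  have hL : MemLp (h ∘ ξ (n + 1)) ∞ μ := by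
    refine memLp_top_of_bound (hh.comp (hξ _)).aestronglyMeasurable 1 (ae_of_all _ fun ω => ?_)
    simp only [h, Function.comp_apply, Set.indicator]
    split_ifs <;> simp
  have hint := hL.integrable le_top
  have h1 := (isMarkov_iff hξ).1 H n h hh hL
  rw [generated_singleton] at h1
  have h2 := h1.trans (condExp_ae_eq_integral_condDistrib (hξ n) (hξ (n + 1)).aemeasurable
    hh.stronglyMeasurable hint)
  have hs : MeasurableSet[generated ξ (Set.Iic n)] ((fun ω k => ξ (min k n) ω) ⁻¹' A) := by
    rw [generated_Iic_eq_comap]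
    exact ⟨A, hA, rfl⟩
  have h3 := setIntegral_condExp (generated_le hξ (Set.Iic n)) hint hs
  have hg : StronglyMeasurable fun s : S => ∫ y, h y ∂condDistrib (ξ (n + 1)) (ξ n) μ s :=
    (hh.stronglyMeasurable.comp_measurable measurable_snd).integral_condDistrib
  have h4 := setIntegral_map (μ := μ) hA
    (hg.comp_measurable (measurable_pi_apply n)).aestronglyMeasurable hX.aemeasurable
  simp only [Function.comp_apply, min_self] at h4
  rw [h4]
  rw [← setIntegral_congr_ae (hX hA) (h2.mono fun ω hω _ => hω), h3]
  rw [← setIntegral_indicator (hξ _ hB)]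
  rfl

/-- A Markov sequence is determined in law by the joint laws of its consecutive members. -/
lemma IsMarkov.map_eq (hξ : ∀ n, Measurable (ξ n)) (hξ' : ∀ n, Measurable (ξ' n))
    (H : IsMarkov μ ξ) (H' : IsMarkov μ' ξ')
    (hpair : ∀ n, μ.map (fun ω => (ξ n ω, ξ (n + 1) ω)) = μ'.map (fun ω => (ξ' n ω, ξ' (n + 1) ω))) :
    μ.map (fun ω n => ξ n ω) = μ'.map (fun ω n => ξ' n ω) := by
  have hX : ∀ n, Measurable (fun ω k => ξ (min k n) ω) := fun n =>
    measurable_pi_lambda _ fun k => hξ _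
  have hX' : ∀ n, Measurable (fun ω k => ξ' (min k n) ω) := fun n =>
    measurable_pi_lambda _ fun k => hξ' _
  have hpast : ∀ n, μ.map (fun ω k => ξ (min k n) ω) = μ'.map (fun ω k => ξ' (min k n) ω) := by
    intro n
    induction n with
    | zero =>
      have h := congrArg (Measure.map fun (p : S × S) (_ : ℕ) => p.1) (hpair 0)
      rw [Measure.map_map (by fun_prop) ((hξ _).prodMk (hξ _)),
        Measure.map_map (by fun_prop) ((hξ' _).prodMk (hξ' _))] at h
      simpa [Function.comp_def] using h
    | succ n ih =>
      have hm := (hX n).prodMk (hξ (n + 1))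
      have hm' := (hX' n).prodMk (hξ' (n + 1))
      have hcd : condDistrib (ξ (n + 1)) (ξ n) μ = condDistrib (ξ' (n + 1)) (ξ' n) μ' := by
        simp only [condDistrib, hpair n]
      have hprod : μ.map (fun ω => ((fun k => ξ (min k n) ω : ℕ → S), ξ (n + 1) ω)) =
          μ'.map (fun ω => ((fun k => ξ' (min k n) ω : ℕ → S), ξ' (n + 1) ω)) := by
        have : IsProbabilityMeasure
          (μ.map (fun ω => ((fun k => ξ (min k n) ω : ℕ → S), ξ (n + 1) ω))) :=
          Measure.isProbabilityMeasure_map hm.aemeasurable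
        refine Measure.ext_prod fun {A B} hA hB => ?_
        rw [Measure.map_apply hm (hA.prod hB), Measure.map_apply hm' (hA.prod hB)]
        have h1 := H.integral_past_inter_next hξ n hA hB
        have h2 := H'.integral_past_inter_next hξ' n hA hB
        rw [hcd, ih, ← h2] at h1
        simp only [setIntegral_const, Measure.real, Complex.real_smul, mul_one,
          Complex.ofReal_inj] at h1
        exact (ENNReal.toReal_eq_toReal_iff' (measure_ne_top _ _) (measure_ne_top _ _)).1 h1
      -- The path frozen at `n + 1` is recovered from the path frozen at `n` and the next variable.
      have hF : Measurable fun (p : (ℕ → S) × S) (k : ℕ) => if k ≤ n then p.1 k else p.2 := by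
        refine measurable_pi_lambda _ fun k => ?_
        split_ifs <;> fun_prop
      have h := congrArg (Measure.map fun (p : (ℕ → S) × S) (k : ℕ) =>
        if k ≤ n then p.1 k else p.2) hprod
      rw [Measure.map_map hF hm, Measure.map_map hF hm'] at h
      convert h using 2 <;>
      · ext ω k
        simp only [Function.comp_apply]
        split_ifs with hk
        · rw [min_eq_left hk, min_eq_left (by omega)]
        · rw [min_eq_right (by omega)]
  have hY : Measurable (fun ω n => ξ n ω) := measurable_pi_lambda _ hξ
  have hY' : Measurable (fun ω n => ξ' n ω) := measurable_pi_lambda _ hξ'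
  have : IsProbabilityMeasure (μ.map fun ω n => ξ n ω) :=
    Measure.isProbabilityMeasure_map hY.aemeasurable
  -- Coordinates in a finite set `I` are unaffected by freezing at the maximum of `I`, so `hpast`
  -- settles all finite-dimensional laws.
  refine IsProjectiveLimit.unique
    (P := fun I : Finset ℕ => (μ.map fun ω n => ξ n ω).map I.restrict) (fun I => rfl) fun I => ?_
  have hI : ∀ (i : I), min (i : ℕ) (I.sup id) = i := fun i =>
    min_eq_left (Finset.le_sup (f := id) i.2)
  have h := congrArg (Measure.map I.restrict) (hpast (I.sup id))
  rw [Measure.map_map (Finset.measurable_restrict I) (hX _),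
    Measure.map_map (Finset.measurable_restrict I) (hX' _)] at h
  simp only []
  rw [Measure.map_map (Finset.measurable_restrict I) hY,
    Measure.map_map (Finset.measurable_restrict I) hY']
  convert h.symm using 2 <;>
  · ext ω i
    simp [Finset.restrict, hI]

end Law

/-! ### Deleting coordinates of an i.i.d. sequence -/

/-- The increasing map `ℕ → ℕ` that omits exactly the value `j`. -/
def omitting (j i : ℕ) : ℕ := if i < j then i else i + 1

lemma omitting_injective (j : ℕ) : Function.Injective (omitting j) := by
  intro a b h
  unfold omitting at h
  split_ifs at h <;> omega

/-- Both sides are the increasing map whose image misses exactly `k` and `l + 1`. -/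
lemma omitting_omitting {k l : ℕ} (h : k ≤ l) (i : ℕ) :
    omitting k (omitting l i) = omitting (l + 1) (omitting k i) := by
  unfold omitting
  split_ifs <;> omega

section Bernoulli

variable {X : Type*} [MeasurableSpace X] (ν : Measure X) [IsProbabilityMeasure ν]

lemma measurePreserving_omitting (j : ℕ) :
    MeasurePreserving (fun (c : ℕ → X) i => c (omitting j i))
      (Measure.infinitePi fun _ => ν) (Measure.infinitePi fun _ => ν) :=
  ⟨by fun_prop, Measure.map_infinitePi_infinitePi_of_inj (P := fun _ => ν) (omitting_injective j)⟩

lemma iIndep_comap_eval :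
    iIndep (fun i : ℕ => MeasurableSpace.comap (fun c : ℕ → X => c i) inferInstance)
      (Measure.infinitePi fun _ => ν) :=
  iIndepFun_infinitePi (P := fun _ : ℕ => ν) (X := fun _ x => x) fun _ => measurable_id

lemma comap_eval_le (i : ℕ) :
    MeasurableSpace.comap (fun c : ℕ → X => c i) inferInstance ≤ MeasurableSpace.pi :=
  (measurable_pi_apply i).comap_le

/-- Measurability of the `n`-fold shift with respect to the coordinates from `n` on. -/
lemma measurable_iterate_omitting_zero (n : ℕ) :
    Measurable[⨆ i ∈ Set.Ici n, MeasurableSpace.comap (fun c : ℕ → X => c i) inferInstance]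
      (fun c : ℕ → X => fun i => c (omitting 0 i))^[n] := by
  have h : (fun c : ℕ → X => fun i => c (omitting 0 i))^[n] = fun c i => c (i + n) := by
    induction n with
    | zero => rfl
    | succ n ih =>
      rw [Function.iterate_succ', ih]
      ext c i
      simp [omitting, add_assoc, add_comm 1 n]
  rw [h]
  refine @measurable_pi_lambda _ _ _ (_) _ _ fun i => ?_
  refine Measurable.mono (comap_measurable fun c : ℕ → X => c (i + n)) ?_ le_rfl
  exact le_iSup₂_of_le (i + n) (Set.mem_Ici.2 (by omega)) le_rfl

/-- The Bernoulli shift is ergodic. -/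
lemma measure_eq_zero_or_one_of_shift_invariant {B : Set (ℕ → X)} (hB : MeasurableSet B)
    (hinv : (fun (c : ℕ → X) i => c (omitting 0 i)) ⁻¹' B =ᵐ[Measure.infinitePi fun _ => ν] B) :
    (Measure.infinitePi fun _ => ν) B = 0 ∨ (Measure.infinitePi fun _ => ν) B = 1 := by
  -- A strictly invariant version `t` equals its preimage under every iterate of the shift, so it is
  -- a tail event and Kolmogorov's zero-one law applies.
  obtain ⟨t, ht, htB, hinv'⟩ :=
    (measurePreserving_omitting ν 0).quasiMeasurePreserving.exists_preimage_eq_of_preimage_ae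
      hB.nullMeasurableSet hinv
  rw [← measure_congr htB]
  refine measure_zero_or_one_of_measurableSet_limsup_atTop comap_eval_le (iIndep_comap_eval ν) ?_
  rw [limsup_eq_iInf_iSup_of_nat, MeasurableSpace.measurableSet_iInf]
  intro n
  have h := measurable_iterate_omitting_zero (X := X) n ht
  rwa [Set.preimage_iterate_eq, Function.iterate_fixed hinv'] at h

/-- The first member of an i.i.d. sequence is independent of the shifted sequence. -/
lemma measurePreserving_head_shift :
    MeasurePreserving (fun c : ℕ → X => (c 0, fun i => c (omitting 0 i)))
      (Measure.infinitePi fun _ => ν) (ν.prod (Measure.infinitePi fun _ => ν)) := by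
  have hs := measurePreserving_omitting ν 0
  have he := measurePreserving_eval_infinitePi (fun _ : ℕ => ν) 0
  have hind : IndepFun (fun c : ℕ → X => c 0) (fun c i => c (omitting 0 i))
      (Measure.infinitePi fun _ => ν) := by
    have h := indep_iSup_of_disjoint comap_eval_le (iIndep_comap_eval ν)
      (S := {0}) (T := Set.Ici 1) (by simp)
    refine indep_of_indep_of_le_left (indep_of_indep_of_le_right h ?_) (by simp)
    exact (measurable_iterate_omitting_zero (X := X) 1).comap_le
  refine ⟨by fun_prop, ?_⟩
  rw [hind.map_prod_eq_prod_map_map he.aemeasurable hs.aemeasurable, hs.map_eq]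
  congr 1
  exact he.map_eq

end Bernoulli

/-! ### The dilation of a random map -/

section Construction

variable {T X : Type*}

/-- The representation of the Thompson monoid on `T × X^ℕ` given by the random map `φ`. -/
def dilation (φ : T → X → T) : ℕ → T × (ℕ → X) → T × (ℕ → X)
  | 0 => fun p => (φ p.1 (p.2 0), fun i => p.2 (omitting 0 i))
  | k + 1 => fun p => (p.1, fun i => p.2 (omitting k i))

lemma dilation_relation {φ : T → X → T} {k l : ℕ} (h : k < l) :
    dilation φ l ∘ dilation φ k = dilation φ k ∘ dilation φ (l + 1) := by
  obtain ⟨l, rfl⟩ := Nat.exists_eq_succ_of_ne_zero (Nat.ne_zero_of_lt h)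
  cases k with
  | zero =>
    ext1 p
    simp [dilation, omitting_omitting (Nat.zero_le l)]
    -- What remains is that entry `0`, read by `φ`, survives the deletion of entry `l + 1`.
    simp [omitting]
  | succ k =>
    ext1 p
    simp [dilation, omitting_omitting (show k ≤ l by omega)]

variable [MeasurableSpace T] [MeasurableSpace X] (π : Measure T) (ν : Measure X)
  [IsProbabilityMeasure π] [IsProbabilityMeasure ν] {φ : T → X → T}

/-- For `k = 0`, split off the first entry, which is independent of the rest, and feed it to `φ`,
which maps `π.prod ν` to `π`. -/
lemma measurePreserving_dilation
    (hφ : MeasurePreserving (Function.uncurry φ) (π.prod ν) π) (k : ℕ) :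
    MeasurePreserving (dilation φ k) (π.prod (Measure.infinitePi fun _ => ν))
      (π.prod (Measure.infinitePi fun _ => ν)) := by
  cases k with
  | zero =>
    exact (hφ.prod (.id _)).comp (((measurePreserving_prodAssoc π ν _).symm).comp
      ((MeasurePreserving.id π).prod (measurePreserving_head_shift ν)))
  | succ k => exact (MeasurePreserving.id π).prod (measurePreserving_omitting ν k)

variable {S : Type*} [MeasurableSpace S] (e : T ≃ᵐ S)

/-- The sequence implemented by `dilation φ`. -/
def dilationSeq (φ : T → X → T) (n : ℕ) (p : T × (ℕ → X)) : S :=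
  e ((dilation φ 0)^[n] p).1

lemma measurable_dilationSeq (hφ : Measurable (Function.uncurry φ)) (n : ℕ) :
    Measurable (dilationSeq e φ n) := by
  have h0 : Measurable (dilation φ 0) := by
    unfold dilation
    exact (hφ.comp (by fun_prop : Measurable fun p : T × (ℕ → X) => (p.1, p.2 0))).prodMk
      (by fun_prop)
  exact e.measurable.comp (measurable_fst.comp (h0.iterate n))

lemma isImplementedBy_dilation
    (hφ : MeasurePreserving (Function.uncurry φ) (π.prod ν) π) :
    IsImplementedBy (π.prod (Measure.infinitePi fun _ => ν)) (dilationSeq e φ) (dilation φ) where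
  measurePreserving := measurePreserving_dilation π ν hφ
  relations _ _ h := dilation_relation h
  localization k hk := by
    obtain ⟨k, rfl⟩ := Nat.exists_eq_succ_of_ne_zero hk.ne'
    rfl
  stationarity _ := rfl

/-- Every `dilation φ k` with `k ≥ 1` fixes the state. Conversely, invariance under `dilation φ 1`,
the full shift on the second factor, already suffices: almost every section is trivial by
ergodicity. -/
lemma isMaximalFor_dilation :
    IsMaximalFor (π.prod (Measure.infinitePi fun _ => ν)) (dilationSeq e φ) (dilation φ) := by
  set P := Measure.infinitePi fun _ : ℕ => ν
  ext A
  simp only [MeasurableSpace.measurableSet_iInf]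
  rw [generated_singleton]
  constructor
  · rintro ⟨⟨_, ⟨t, ht, rfl⟩, hA⟩, hAm⟩ k hk
    obtain ⟨k, rfl⟩ := Nat.exists_eq_succ_of_ne_zero (Nat.ne_of_gt (Set.mem_Ici.1 hk))
    refine ⟨hAm, ?_⟩
    have hq : Measure.QuasiMeasurePreserving (dilation φ (k + 1)) (π.prod P) (π.prod P) :=
      ((MeasurePreserving.id π).prod (measurePreserving_omitting ν k)).quasiMeasurePreserving
    exact (hq.preimage_ae_eq hA).trans hA.symm
  · intro H
    obtain ⟨hAm, hA⟩ := H 1 (Set.mem_Ici.2 le_rfl)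
    have hsec : ∀ᵐ x ∂π, P (Prod.mk x ⁻¹' A) = 0 ∨ P (Prod.mk x ⁻¹' A) = 1 := by
      filter_upwards [Measure.ae_ae_of_ae_prod hA] with x hx
      exact measure_eq_zero_or_one_of_shift_invariant ν (measurable_prodMk_left hAm) hx
    have hg : Measurable fun x => P (Prod.mk x ⁻¹' A) := measurable_measure_prodMk_left hAm
    -- The given set agrees almost everywhere with the cylinder over the states whose section has
    -- full measure.
    set t : Set T := {x | P (Prod.mk x ⁻¹' A) = 1}
    have ht : MeasurableSet t := hg (measurableSet_singleton 1)
    refine ⟨⟨Prod.fst ⁻¹' t, ⟨e.symm ⁻¹' t, e.symm.measurable ht, ?_⟩, ?_⟩, hAm⟩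
    · ext p
      simp [dilationSeq]
    · refine ((measure_symmDiff_eq_zero_iff).1 ?_)
      have hd : MeasurableSet (symmDiff A (Prod.fst ⁻¹' t)) := hAm.symmDiff (measurable_fst ht)
      rw [Measure.measure_prod_null hd]
      filter_upwards [hsec] with x hx
      by_cases hxt : x ∈ t
      · have : Prod.mk x ⁻¹' symmDiff A (Prod.fst ⁻¹' t) = (Prod.mk x ⁻¹' A)ᶜ := by
          ext c; simp [Set.mem_symmDiff, hxt]
        rw [this]
        exact (prob_compl_eq_zero_iff (measurable_prodMk_left hAm)).2 hxt
      · have : Prod.mk x ⁻¹' symmDiff A (Prod.fst ⁻¹' t) = Prod.mk x ⁻¹' A := by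
          ext c; simp [Set.mem_symmDiff, hxt]
        rw [this]
        exact hx.resolve_right hxt

end Construction

/-! ### From Markov sequences to maximal implementations -/

/-- Every standard Borel space is isomorphic to one in any given universe. -/
lemma exists_measurableEquiv_universe.{u, v} (S : Type v) [MeasurableSpace S] [StandardBorelSpace S] :
    ∃ (T : Type u) (_ : MeasurableSpace T) (_ : StandardBorelSpace T), Nonempty (T ≃ᵐ S) := by
  have hS := measurableEmbedding_embeddingReal S
  have hU : Topology.IsClosedEmbedding (ULift.down : ULift.{u} ℝ → ℝ) :=
    Homeomorph.ulift.isClosedEmbedding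
  have : PolishSpace (ULift.{u} ℝ) := hU.polishSpace
  have : BorelSpace (ULift.{u} ℝ) :=
    (MeasurableEquiv.ulift : ULift.{u} ℝ ≃ᵐ ℝ).measurableEmbedding.borelSpace hU.isInducing
  let g : S → ULift.{u} ℝ := fun s => ULift.up (embeddingReal S s)
  have hg : MeasurableEmbedding g :=
    (MeasurableEquiv.ulift : ULift.{u} ℝ ≃ᵐ ℝ).symm.measurableEmbedding.comp hS
  exact ⟨Set.range g, inferInstance, hg.measurableSet_range.standardBorel,
    ⟨hg.equivRange.symm⟩⟩

/-- A measure and a kernel presented by a random map. -/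
lemma map_prod_eq_compProd {S X : Type*} [MeasurableSpace S] [MeasurableSpace X] (ρ : Measure S)
    (ν : Measure X) [IsProbabilityMeasure ρ] [IsProbabilityMeasure ν] (κ : Kernel S S)
    [IsMarkovKernel κ] {φ : S → X → S} (hφ : Measurable (Function.uncurry φ))
    (h : ∀ s, ν.map (φ s) = κ s) :
    (ρ.prod ν).map (fun p => (p.1, φ p.1 p.2)) = ρ.compProd κ := by
  have hm : Measurable fun p : S × X => (p.1, φ p.1 p.2) := measurable_fst.prodMk hφ
  ext A hA
  rw [Measure.map_apply hm hA, Measure.prod_apply (hm hA), Measure.compProd_apply hA]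
  refine lintegral_congr fun s => ?_
  rw [← h s, Measure.map_apply hφ.of_uncurry_left (measurable_prodMk_left hA)]
  rfl

lemma IsStationary.map_pair {Ω S : Type*} [MeasurableSpace Ω] [MeasurableSpace S]
    {μ : Measure Ω} {ξ : ℕ → Ω → S} (H : IsStationary μ ξ) (hξ : ∀ n, Measurable (ξ n)) (n : ℕ) :
    μ.map (fun ω => (ξ n ω, ξ (n + 1) ω)) = μ.map (fun ω => (ξ 0 ω, ξ 1 ω)) := by
  have h := congrArg (Measure.map fun x : ℕ → S => (x 0, x 1)) (H n)
  rwa [Measure.map_map (by fun_prop) (measurable_pi_lambda _ fun k => hξ _),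
    Measure.map_map (by fun_prop) (measurable_pi_lambda _ fun k => hξ _)] at h

lemma isMaximalPartiallySpreadable_of_isMarkov.{u, v} {Ω : Type u} {S : Type v} [MeasurableSpace Ω]
    [MeasurableSpace S] [StandardBorelSpace S] {μ : Measure Ω} [IsProbabilityMeasure μ]
    {ξ : ℕ → Ω → S} (hξ : ∀ n, Measurable (ξ n)) (hs : IsStationary μ ξ) (hM : IsMarkov μ ξ) :
    IsMaximalPartiallySpreadable μ ξ := by
  have : Nonempty S := (nonempty_of_isProbabilityMeasure μ).map (ξ 0)
  -- The implementing space must lie in the universe of `Ω`, so the state space is replaced by a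
  -- copy there.
  obtain ⟨T, _, _, ⟨e⟩⟩ := exists_measurableEquiv_universe.{u, v} S
  obtain ⟨φ, hφ, hκ⟩ :=
    Kernel.exists_measurable_map_eq_unitInterval (condDistrib (ξ 1) (ξ 0) μ)
  set ν : Measure unitInterval := volume
  set ρ := μ.map (ξ 0)
  have : IsProbabilityMeasure ρ := Measure.isProbabilityMeasure_map (hξ 0).aemeasurable
  have hpair : (ρ.prod ν).map (fun p => (p.1, φ p.1 p.2)) = μ.map (fun ω => (ξ 0 ω, ξ 1 ω)) := by
    rw [map_prod_eq_compProd ρ ν _ hφ hκ]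
    exact compProd_map_condDistrib (hξ 1).aemeasurable
  have hφm : Measurable fun p : S × unitInterval => (p.1, φ p.1 p.2) := measurable_fst.prodMk hφ
  -- The law of `φ` under `ρ.prod ν` is that of `ξ 1`, which is `ρ` by stationarity.
  have hφρ : MeasurePreserving (Function.uncurry φ) (ρ.prod ν) ρ := by
    refine ⟨hφ, ?_⟩
    have h1 := congrArg (Measure.map Prod.snd) hpair
    rw [Measure.map_map measurable_snd hφm,
      Measure.map_map measurable_snd ((hξ 0).prodMk (hξ 1))] at h1
    have h2 := congrArg (Measure.map fun x : ℕ → S => x 0) (hs 1)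
    rw [Measure.map_map (by fun_prop) (measurable_pi_lambda _ fun k => hξ _),
      Measure.map_map (by fun_prop) (measurable_pi_lambda _ fun k => hξ _)] at h2
    exact h1.trans h2
  set π := ρ.map e.symm
  have he' : MeasurePreserving e.symm ρ π := e.symm.measurable.measurePreserving ρ
  have he : MeasurePreserving e π ρ := he'.symm
  have : IsProbabilityMeasure π := Measure.isProbabilityMeasure_map e.symm.measurable.aemeasurable
  set ψ : T → unitInterval → T := fun x u => e.symm (φ (e x) u)
  have hψ : MeasurePreserving (Function.uncurry ψ) (π.prod ν) π :=
    he'.comp (hφρ.comp (he.prod (.id ν)))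
  have hξ' := measurable_dilationSeq e hψ.measurable
  have himp := isImplementedBy_dilation π ν e hψ
  have hmax := isMaximalFor_dilation π ν e (φ := ψ)
  refine ⟨T × (ℕ → unitInterval), inferInstance, inferInstance,
    π.prod (Measure.infinitePi fun _ => ν), dilationSeq e ψ, dilation ψ, inferInstance, hξ', himp,
    hmax, ?_⟩
  -- The implication already proved makes the dilated sequence stationary and Markov, so only the
  -- law of its first two members is left to compare.
  refine hM.map_eq hξ hξ' (himp.isMarkov hξ' hmax) fun n => ?_
  rw [hs.map_pair hξ, (himp.isStationary hξ').map_pair hξ', ← hpair]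
  have hev : MeasurePreserving (fun p : T × (ℕ → unitInterval) => (e p.1, p.2 0))
      (π.prod (Measure.infinitePi fun _ => ν)) (ρ.prod ν) :=
    he.prod (measurePreserving_eval_infinitePi (fun _ : ℕ => ν) 0)
  rw [← hev.map_eq, Measure.map_map hφm hev.measurable]
  congr 1
  ext p
  · rfl
  · simp [dilationSeq, dilation, ψ]

end PartialSpread

theorem theorem1p1 {Ω S : Type*} [MeasurableSpace Ω] [MeasurableSpace S] [StandardBorelSpace S]
    (μ : Measure Ω) [IsProbabilityMeasure μ] (ξ : ℕ → Ω → S) (hξ : ∀ n, Measurable (ξ n)) :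
    PartialSpread.IsMaximalPartiallySpreadable μ ξ ↔
      PartialSpread.IsStationary μ ξ ∧ PartialSpread.IsMarkov μ ξ := by
  constructor
  · rintro ⟨Ω', _, _, μ', ξ', η, _, hξ', himp, hmax, hlaw⟩
    exact ⟨PartialSpread.isStationary_of_map_eq hξ hξ' hlaw (himp.isStationary hξ'),
      PartialSpread.isMarkov_of_map_eq hξ hξ' hlaw (himp.isMarkov hξ' hmax)⟩
  · rintro ⟨hs, hM⟩
    exact PartialSpread.isMaximalPartiallySpreadable_of_isMarkov hξ hs hM
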